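/- Let $K$ be a commutative ring with $1 \neq 0$ and let $G$ be a finitely generated group of type $FP_2$ over $K$; that is, the trivial $KG$-module $K$ has a resolution $\cdots \to P_2 \to P_1 \to P_0 \to K \to 0$ by projective $KG$-modules in which $P_0, P_1, P_2$ are finitely generated. Let $\chi\colon G \to \mathbb{Z}$ be a rank 1 character (a non-zero homomorphism) and let $t \in G$ be an element with $\chi(t) = 1$. Then there exist finitely generated subgroups $S$, $T$, $B$ of $\ker \chi$ with $S \subseteq B$ and $T \subseteq B$, such that conjugation by $t$ induces an isomorphism $\mu\colon S \to T$, $\mu(s) = t s t^{-1}$ (so $T = tSt^{-1}$), and such that the inclusion $B \hookrightarrow G$ and the assignment $y \mapsto t$ induce an isomorphism $$\tau\colon \langle B, y \mid y s y^{-1} = \mu(s) \text{ for all } s \in S\rangle \longrightarrow G .$$ That is, $G$ is an HNN-extension with stable letter $t$, finitely generated base group $B \subseteq \ker\chi$ and finitely generated associated subgroups $S$ and $T$. -/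

import Mathlib

universe u v

/-- A (left) module `A` over a ring `R` is of type `FP_n` if it has a projective resolution
`⋯ → P₂ → P₁ → P₀ → A → 0` in which `P₀, …, Pₙ` are finitely generated.
(Taking the `P i` in the universe of `R` is no restriction: finitely generated modules and the
kernels of maps between them have copies there.) -/
def Module.IsTypeFP (R : Type u) [Ring R] (A : Type v) [AddCommGroup A] [Module R A] (n : ℕ) :
    Prop :=
  ∃ (P : ℕ → ModuleCat.{u} R) (d : ∀ i, P (i + 1) →ₗ[R] P i) (ε : P 0 →ₗ[R] A),
    Function.Surjective ε ∧ Function.Exact (d 0) ε ∧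
    (∀ i, Function.Exact (d (i + 1)) (d i)) ∧
    (∀ i, Module.Projective R (P i)) ∧
    (∀ i, i ≤ n → Module.Finite R (P i))

/-- The module `K` over the group ring of `G` on which every element of `G` acts as the
identity. -/
abbrev TrivialGroupModule (K : Type u) [CommRing K] (G : Type v) [Group G] : Type u :=
  (Representation.trivial K G K).asModule

/-- A group `G` is of type `FP_n` over a commutative ring `K` if the trivial module `K` over the
group ring `K[G]` is of type `FP_n`. -/
def Group.IsTypeFP (K : Type u) [CommRing K] (G : Type v) [Group G] (n : ℕ) : Prop :=
  Module.IsTypeFP (MonoidAlgebra K G) (TrivialGroupModule K G) n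

/-!
Choose `x₁, …, x_m ∈ ker χ` that generate `G` together with `t`. By Fox calculus the relation module
of this presentation is the kernel of `K[G]^(m+1) → K[G]`, so `FP₂` and Schanuel's argument make it
finitely generated. Hence finitely many relators decide whether a derivation of the free group with
values in a `K[G]`-module descends to `G`.

Let `B`, `S`, `T` be generated by the conjugates `t ^ k * x i * t ^ (-k)` with `0 ≤ k ≤ n`,
`0 ≤ k < n` and `0 < k ≤ n`. For large `n` a conjugate of each of these relators is a word in the
generators of `B`, so the derivation `x i ↦ 0`, `t ↦ T` with values in `K[G ⧸ T]` descends to a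
derivation `δ` of `G` that vanishes on `B`.

Consider the graph with vertices `G ⧸ B` and edges `G ⧸ T`, where `g T` joins `g B` to `g t B`. The
coefficient of `δ` at the coset `T` is a function on the vertices that changes only along the edge
`T`, where it passes from `0` to `1`. So this edge, and with it each of its translates, separates
the graph. A reduced word of the HNN extension moves the base vertex through a nested sequence of
half-spaces and is therefore nontrivial in `G`.
-/

section ProjectiveResolutions

variable {R : Type*} [Ring R]

theorem exists_comp_eq_of_exact {L M N Q : Type*} [AddCommGroup L] [Module R L] [AddCommGroup M]
    [Module R M] [AddCommGroup N] [Module R N] [AddCommGroup Q] [Module R Q]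
    [Module.Projective R Q] {f : L →ₗ[R] M} {g : M →ₗ[R] N} (h : Function.Exact f g)
    (v : Q →ₗ[R] M) (hv : g ∘ₗ v = 0) : ∃ w : Q →ₗ[R] L, f ∘ₗ w = v := by
  obtain ⟨w, hw⟩ := Module.projective_lifting_property f.rangeRestrict
    (v.codRestrict (LinearMap.range f) fun x => (h _).1 (LinearMap.congr_fun hv x))
    f.surjective_rangeRestrict
  exact ⟨w, LinearMap.ext fun x => congrArg Subtype.val (LinearMap.congr_fun hw x)⟩

-- With comparison maps `a : F → P`, `b : P → F` and a homotopy `h` from `b ∘ a` to the identity,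
-- every `z ∈ ker ∂` is the sum of `b₁ (a₁ z) ∈ b₁ (range d₁)` and `(1 - b₁ a₁ - h ∂) z`.
theorem fg_ker_of_exact_of_projective {A P₀ P₁ P₂ F₀ F₁ : Type*}
    [AddCommGroup A] [Module R A] [AddCommGroup P₀] [Module R P₀] [AddCommGroup P₁] [Module R P₁]
    [AddCommGroup P₂] [Module R P₂] [AddCommGroup F₀] [Module R F₀] [AddCommGroup F₁] [Module R F₁]
    [Module.Projective R P₀] [Module.Projective R P₁] [Module.Projective R F₀]
    [Module.Projective R F₁] [Module.Finite R P₂] [Module.Finite R F₁]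
    {d₁ : P₂ →ₗ[R] P₁} {d₀ : P₁ →ₗ[R] P₀} {ε : P₀ →ₗ[R] A} (hε : Function.Surjective ε)
    (h₀ : Function.Exact d₀ ε) (h₁ : Function.Exact d₁ d₀)
    {δ : F₁ →ₗ[R] F₀} {η : F₀ →ₗ[R] A} (hη : Function.Surjective η) (hδ : Function.Exact δ η) :
    (LinearMap.ker δ).FG := by
  obtain ⟨a₀, ha₀⟩ := Module.projective_lifting_property ε η hε
  obtain ⟨b₀, hb₀⟩ := Module.projective_lifting_property η ε hη
  obtain ⟨a₁, ha₁⟩ := exists_comp_eq_of_exact h₀ (a₀ ∘ₗ δ) (by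
    rw [← LinearMap.comp_assoc, ha₀, hδ.linearMap_comp_eq_zero])
  obtain ⟨b₁, hb₁⟩ := exists_comp_eq_of_exact hδ (b₀ ∘ₗ d₀) (by
    rw [← LinearMap.comp_assoc, hb₀, h₀.linearMap_comp_eq_zero])
  obtain ⟨h, hh⟩ := exists_comp_eq_of_exact hδ (LinearMap.id - b₀ ∘ₗ a₀) (by
    rw [LinearMap.comp_sub, LinearMap.comp_id, ← LinearMap.comp_assoc, hb₀, ha₀, sub_self])
  have key : LinearMap.ker δ =
      LinearMap.range (b₁ ∘ₗ d₁) ⊔ LinearMap.range (LinearMap.id - b₁ ∘ₗ a₁ - h ∘ₗ δ) := by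
    have hda (z) : d₀ (a₁ z) = a₀ (δ z) := LinearMap.congr_fun ha₁ z
    have hdb (z) : δ (b₁ z) = b₀ (d₀ z) := LinearMap.congr_fun hb₁ z
    have hdh (z) : δ (h z) = z - b₀ (a₀ z) := LinearMap.congr_fun hh z
    refine le_antisymm (fun z hz => ?_) (sup_le ?_ ?_)
    · rw [LinearMap.mem_ker] at hz
      obtain ⟨p, hp⟩ := (h₁ (a₁ z)).1 (by rw [hda, hz, map_zero])
      exact Submodule.mem_sup.2
        ⟨b₁ (d₁ p), ⟨p, rfl⟩, z - b₁ (a₁ z), ⟨z, by simp [hz]⟩, by rw [hp]; abel⟩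
    · rintro _ ⟨p, rfl⟩
      simp [hdb, h₁.apply_apply_eq_zero]
    · rintro _ ⟨z, rfl⟩
      simp [hdb, hda, hdh]
  rw [key, LinearMap.range_eq_map, LinearMap.range_eq_map]
  exact (Module.Finite.fg_top.map _).sup (Module.Finite.fg_top.map _)

end ProjectiveResolutions

/-- A crossed homomorphism (derivation, 1-cocycle) from `H` to an `R`-module on which `H` acts
through `u : H →* R`. -/
def IsCrossedHom {H R A : Type*} [Group H] [Ring R] [AddCommGroup A] [Module R A] (u : H →* R)
    (d : H → A) : Prop :=
  ∀ x y, d (x * y) = d x + u x • d y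

namespace IsCrossedHom

variable {H R A : Type*} [Group H] [Ring R] [AddCommGroup A] [Module R A] {u : H →* R} {d : H → A}

theorem map_one (hd : IsCrossedHom u d) : d 1 = 0 := by
  simpa using hd 1 1

theorem map_inv (hd : IsCrossedHom u d) (x : H) : d x⁻¹ = -(u x⁻¹ • d x) := by
  rw [eq_neg_iff_add_eq_zero, ← hd, inv_mul_cancel, hd.map_one]

theorem map_conj (hd : IsCrossedHom u d) (x y : H) :
    d (x * y * x⁻¹) = d x + u x • d y - u (x * y * x⁻¹) • d x := by
  rw [hd, hd, hd.map_inv, smul_neg, smul_smul, ← map_mul, sub_eq_add_neg]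

theorem eq_zero_of_map_conj_eq_zero (hd : IsCrossedHom u d) {x y : H} (hy : u y = 1)
    (h : d (x * y * x⁻¹) = 0) : d y = 0 := by
  have hconj : u (x * y * x⁻¹) = 1 := by
    rw [map_mul, map_mul, hy, mul_one, ← map_mul, mul_inv_cancel, MonoidHom.map_one]
  rw [hd.map_conj, hconj, one_smul, add_sub_cancel_left] at h
  rw [← one_smul R (d y), ← u.map_one, ← inv_mul_cancel x, map_mul, mul_smul, h, smul_zero]

theorem linearMap_comp {A' : Type*} [AddCommGroup A'] [Module R A'] (hd : IsCrossedHom u d)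
    (f : A →ₗ[R] A') : IsCrossedHom u (f ∘ d) := fun x y => by
  simp [hd x y]

theorem sub {d' : H → A} (hd : IsCrossedHom u d) (hd' : IsCrossedHom u d') :
    IsCrossedHom u (d - d') := fun x y => by
  simp only [Pi.sub_apply, hd x y, hd' x y, smul_sub]
  abel

variable (u) in
theorem map_sub_one : IsCrossedHom u fun x => u x - 1 := fun x y => by
  beta_reduce
  rw [map_mul, smul_eq_mul, mul_sub, mul_one]
  abel

theorem eq_zero_of_mem_closure (hd : IsCrossedHom u d) {s : Set H} (hs : ∀ x ∈ s, d x = 0) {x : H}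
    (hx : x ∈ Subgroup.closure s) : d x = 0 := by
  induction hx using Subgroup.closure_induction with
  | mem x hx => exact hs x hx
  | one => exact hd.map_one
  | mul x y _ _ hx hy => rw [hd, hx, hy, smul_zero, add_zero]
  | inv x _ hx => rw [hd.map_inv, hx, smul_zero, neg_zero]

theorem exists_descent {G : Type*} [Group G] {v : G →* R} {φ : H →* G}
    (hφ : Function.Surjective φ) (hd : IsCrossedHom (v.comp φ) d) (h0 : ∀ r ∈ φ.ker, d r = 0) :
    ∃ δ : G → A, IsCrossedHom v δ ∧ ∀ x, δ (φ x) = d x := by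
  obtain ⟨σ, hσ⟩ := hφ.hasRightInverse
  have hdσ (x : H) : d (σ (φ x)) = d x := by
    have hker : x⁻¹ * σ (φ x) ∈ φ.ker := by simp [MonoidHom.mem_ker, hσ (φ x)]
    rw [← mul_inv_cancel_left x (σ (φ x)), hd, h0 _ hker, smul_zero, add_zero]
  refine ⟨d ∘ σ, fun g g' => ?_, hdσ⟩
  obtain ⟨x, rfl⟩ := hφ g
  obtain ⟨y, rfl⟩ := hφ g'
  rw [← map_mul]
  simp only [Function.comp_apply, hdσ]
  exact hd x y

end IsCrossedHom

section FoxCalculus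

variable {X R : Type*} [Ring R] (u : FreeGroup X →* R)

/-- The multiplication action of the units of `R` on the free module `X →₀ R`, written
multiplicatively so that it defines a semidirect product. -/
noncomputable def unitsMulAut (X R : Type*) [Ring R] : Rˣ →* MulAut (Multiplicative (X →₀ R)) :=
  (MulAutMultiplicative (X →₀ R)).symm.toMonoidHom.comp (DistribMulAction.toAddAut Rˣ (X →₀ R))

/-- The homomorphism `w ↦ (∂w, u w)` to the semidirect product, whose first coordinate is the
vector of Fox derivatives. -/
noncomputable def foxHom : FreeGroup X →* Multiplicative (X →₀ R) ⋊[unitsMulAut X R] Rˣ :=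
  FreeGroup.lift fun x => ⟨.ofAdd (.single x 1), u.toHomUnits (.of x)⟩

/-- The vector of Fox derivatives of a word: the universal crossed homomorphism along `u` on a free
group, sending the generator `x` to the basis vector `e_x`. -/
noncomputable def foxDeriv (w : FreeGroup X) : X →₀ R :=
  (foxHom u w).left.toAdd

theorem foxDeriv_of (x : X) : foxDeriv u (.of x) = .single x 1 := by
  simp [foxDeriv, foxHom]

theorem foxHom_right (w : FreeGroup X) : (foxHom u w).right = u.toHomUnits w := by
  refine DFunLike.congr_fun (f := SemidirectProduct.rightHom.comp (foxHom u)) ?_ w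
  ext x
  simp [foxHom]

theorem isCrossedHom_foxDeriv : IsCrossedHom u (foxDeriv u) := fun v w => by
  simp only [foxDeriv, map_mul, SemidirectProduct.mul_left, foxHom_right, toAdd_mul]
  rfl

variable {u}

theorem IsCrossedHom.eq_linearCombination_foxDeriv {A : Type*} [AddCommGroup A] [Module R A]
    {d : FreeGroup X → A} (hd : IsCrossedHom u d) (w : FreeGroup X) :
    d w = Finsupp.linearCombination R (fun x => d (.of x)) (foxDeriv u w) := by
  rw [← sub_eq_zero]
  refine (hd.sub ((isCrossedHom_foxDeriv u).linearMap_comp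
    (Finsupp.linearCombination R fun x => d (.of x)))).eq_zero_of_mem_closure
      (s := Set.range FreeGroup.of) ?_ (by simp [FreeGroup.closure_range_of])
  rintro _ ⟨x, rfl⟩
  simp [foxDeriv_of]

variable (u) in
theorem exists_isCrossedHom_of_eq {A : Type*} [AddCommGroup A] [Module R A] (f : X → A) :
    ∃ d : FreeGroup X → A, IsCrossedHom u d ∧ ∀ x, d (.of x) = f x :=
  ⟨_, (isCrossedHom_foxDeriv u).linearMap_comp (Finsupp.linearCombination R f), fun x => by
    simp [foxDeriv_of]⟩

variable (u) in
/-- The boundary map `e_x ↦ u x - 1` of the Fox resolution. -/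
noncomputable def foxBoundary : (X →₀ R) →ₗ[R] R :=
  Finsupp.linearCombination R fun x => u (.of x) - 1

theorem foxBoundary_foxDeriv (w : FreeGroup X) : foxBoundary u (foxDeriv u w) = u w - 1 :=
  ((IsCrossedHom.map_sub_one u).eq_linearCombination_foxDeriv w).symm

end FoxCalculus

section GroupRing

open MonoidAlgebra

variable (K : Type*) [CommRing K] (G : Type*) [Group G]

/-- The augmentation of the group ring, as a map onto the trivial module. -/
noncomputable def trivialAugmentation :
    MonoidAlgebra K G →ₗ[MonoidAlgebra K G] TrivialGroupModule K G :=
  LinearMap.toSpanSingleton _ _ ((Representation.trivial K G K).asModuleEquiv.symm 1)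

theorem trivialAugmentation_of (g : G) :
    trivialAugmentation K G (of K G g) = (Representation.trivial K G K).asModuleEquiv.symm 1 := by
  rw [trivialAugmentation, LinearMap.toSpanSingleton_apply,
    ← Representation.asModuleEquiv_symm_map_rho]
  rfl

theorem trivialAugmentation_algebraMap (k : K) :
    trivialAugmentation K G (algebraMap K _ k) =
      (Representation.trivial K G K).asModuleEquiv.symm k := by
  rw [trivialAugmentation, LinearMap.toSpanSingleton_apply,
    ← Representation.asModuleEquiv_symm_map_smul, smul_eq_mul, mul_one]

theorem trivialAugmentation_surjective : Function.Surjective (trivialAugmentation K G) :=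
  fun y => ⟨algebraMap K _ ((Representation.trivial K G K).asModuleEquiv y), by
    rw [trivialAugmentation_algebraMap, LinearEquiv.symm_apply_apply]⟩

variable {G} {X : Type*} {φ : FreeGroup X →* G}

theorem trivialAugmentation_foxBoundary (v : X →₀ MonoidAlgebra K G) :
    trivialAugmentation K G (foxBoundary ((of K G).comp φ) v) = 0 := by
  suffices trivialAugmentation K G ∘ₗ foxBoundary ((of K G).comp φ) = 0 from
    LinearMap.congr_fun this v
  refine Finsupp.lhom_ext fun x r => ?_
  have h1 : trivialAugmentation K G 1 = (Representation.trivial K G K).asModuleEquiv.symm 1 := by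
    rw [← trivialAugmentation_of K G 1, MonoidHom.map_one]
  simp only [foxBoundary, LinearMap.comp_apply, Finsupp.linearCombination_single, map_smul, map_sub,
    MonoidHom.comp_apply, trivialAugmentation_of, h1, sub_self, smul_zero, LinearMap.zero_apply]

theorem exists_sub_algebraMap_mem_range_foxBoundary (hφ : Function.Surjective φ)
    (r : MonoidAlgebra K G) :
    ∃ k : K, r - algebraMap K _ k ∈ LinearMap.range (foxBoundary ((of K G).comp φ)) := by
  induction r using MonoidAlgebra.induction_on with
  | of g =>
    obtain ⟨w, rfl⟩ := hφ g
    exact ⟨1, foxDeriv _ w, by rw [foxBoundary_foxDeriv, map_one, MonoidHom.comp_apply]⟩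
  | add a b ha hb =>
    obtain ⟨k, hk⟩ := ha
    obtain ⟨l, hl⟩ := hb
    exact ⟨k + l, by simpa only [map_add, add_sub_add_comm] using add_mem hk hl⟩
  | smul c a ha =>
    obtain ⟨k, hk⟩ := ha
    refine ⟨c * k, ?_⟩
    rw [map_mul, Algebra.smul_def, ← mul_sub]
    exact Submodule.smul_mem _ _ hk

theorem exact_foxBoundary_trivialAugmentation (hφ : Function.Surjective φ) :
    Function.Exact (foxBoundary ((of K G).comp φ)) (trivialAugmentation K G) := by
  intro r
  refine ⟨fun hr => ?_, ?_⟩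
  · obtain ⟨k, v, hv⟩ := exists_sub_algebraMap_mem_range_foxBoundary K hφ r
    have hk := trivialAugmentation_foxBoundary K (φ := φ) v
    rw [hv, map_sub, hr, trivialAugmentation_algebraMap, zero_sub, neg_eq_zero,
      LinearEquiv.map_eq_zero_iff] at hk
    exact ⟨v, by rw [hv, hk, map_zero, sub_zero]⟩
  · rintro ⟨v, rfl⟩
    exact trivialAugmentation_foxBoundary K v

variable {K}

theorem IsCrossedHom.exists_linearMap_mul_sub_one {A : Type*} [AddCommGroup A] [Module K A]
    [Module (MonoidAlgebra K G) A] [IsScalarTower K (MonoidAlgebra K G) A] {d : G → A}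
    (hd : IsCrossedHom (of K G) d) :
    ∃ s : MonoidAlgebra K G →ₗ[K] A, ∀ r g, s (r * (of K G g - 1)) = r • d g := by
  let s : MonoidAlgebra K G →ₗ[K] A :=
    Finsupp.linearCombination K d ∘ₗ (coeffLinearEquiv K).toLinearMap
  have hs (g : G) : s (of K G g) = d g := by simp [s]
  refine ⟨s, fun r g => ?_⟩
  induction r using MonoidAlgebra.induction_on with
  | of h => rw [mul_sub, mul_one, ← map_mul, map_sub, hs, hs, hd, add_sub_cancel_left]
  | add a b ha hb => rw [add_mul, map_add, ha, hb, add_smul]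
  | smul c a ha => rw [smul_mul_assoc, map_smul, ha, smul_assoc]

-- Modulo the span of the relators, the Fox derivative descends to a derivation of `G`, whose
-- `K`-linear extension is a left inverse of the Fox boundary map.
theorem ker_foxBoundary_eq_span (hφ : Function.Surjective φ) :
    LinearMap.ker (foxBoundary ((of K G).comp φ)) =
      Submodule.span (MonoidAlgebra K G) (foxDeriv ((of K G).comp φ) '' φ.ker) := by
  set L := Submodule.span (MonoidAlgebra K G) (foxDeriv ((of K G).comp φ) '' φ.ker)
  refine le_antisymm (fun v hv => ?_) (Submodule.span_le.2 ?_)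
  · obtain ⟨E, hE, hEφ⟩ := ((isCrossedHom_foxDeriv ((of K G).comp φ)).linearMap_comp
      L.mkQ).exists_descent hφ fun r hr => by
        simpa using Submodule.subset_span (Set.mem_image_of_mem _ hr)
    obtain ⟨s, hs⟩ := hE.exists_linearMap_mul_sub_one
    have hs_foxBoundary (v) : s (foxBoundary ((of K G).comp φ) v) = L.mkQ v := by
      induction v using Finsupp.induction_linear with
      | zero => simp
      | add v w hv hw => simp only [map_add, hv, hw]
      | single x r =>
        rw [foxBoundary, Finsupp.linearCombination_single, smul_eq_mul, MonoidHom.comp_apply, hs,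
          hEφ, Function.comp_apply, foxDeriv_of, ← map_smul, Finsupp.smul_single, smul_eq_mul,
          mul_one]
    rw [← L.ker_mkQ, LinearMap.mem_ker, ← hs_foxBoundary, hv, map_zero]
  · rintro _ ⟨r, hr, rfl⟩
    rw [SetLike.mem_coe, LinearMap.mem_ker, foxBoundary_foxDeriv, MonoidHom.comp_apply,
      (hr : φ r = 1), map_one, sub_self]

end GroupRing

theorem exists_finite_span_foxDeriv_eq {K G : Type*} [CommRing K] [Group G]
    (hG : Group.IsTypeFP K G 2) {X : Type*} [Finite X] {φ : FreeGroup X →* G}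
    (hφ : Function.Surjective φ) :
    ∃ R : Set (FreeGroup X), R.Finite ∧ R ⊆ φ.ker ∧
      Submodule.span (MonoidAlgebra K G) (foxDeriv ((MonoidAlgebra.of K G).comp φ) '' R) =
        Submodule.span _ (foxDeriv ((MonoidAlgebra.of K G).comp φ) '' φ.ker) := by
  obtain ⟨P, d, ε, hε, h₀, h, hproj, hfin⟩ := hG
  have := hproj 0
  have := hproj 1
  have := hfin 2 le_rfl
  have hfg := fg_ker_of_exact_of_projective hε h₀ (h 0) (trivialAugmentation_surjective K G)
    (exact_foxBoundary_trivialAugmentation K hφ)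
  rw [ker_foxBoundary_eq_span hφ, Submodule.fg_span_iff_fg_span_finset_subset] at hfg
  obtain ⟨s, hs, hspan⟩ := hfg
  classical
  obtain ⟨R, hR, rfl⟩ := Finset.subset_set_image_iff.1 hs
  exact ⟨R, R.finite_toSet, hR, by rw [← Finset.coe_image, hspan]⟩

theorem exists_finite_relators {K G : Type*} [CommRing K] [Group G]
    (hG : Group.IsTypeFP K G 2) {X : Type*} [Finite X] {φ : FreeGroup X →* G}
    (hφ : Function.Surjective φ) :
    ∃ R : Set (FreeGroup X), R.Finite ∧ R ⊆ φ.ker ∧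
      ∀ {A : Type*} [AddCommGroup A] [Module (MonoidAlgebra K G) A] {d : FreeGroup X → A},
        IsCrossedHom ((MonoidAlgebra.of K G).comp φ) d → (∀ r ∈ R, d r = 0) →
          ∀ r ∈ φ.ker, d r = 0 := by
  obtain ⟨R, hRfin, hRker, hR⟩ := exists_finite_span_foxDeriv_eq hG hφ
  refine ⟨R, hRfin, hRker, fun {A} _ _ d hd hdR r hr => ?_⟩
  set l := Finsupp.linearCombination (MonoidAlgebra K G) fun x => d (.of x)
  have hspan : Submodule.span _ (foxDeriv ((MonoidAlgebra.of K G).comp φ) '' R) ≤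
      LinearMap.ker l := by
    rw [Submodule.span_le]
    rintro _ ⟨q, hq, rfl⟩
    exact (hd.eq_linearCombination_foxDeriv q).symm.trans (hdR q hq)
  rw [hd.eq_linearCombination_foxDeriv r]
  exact hspan (hR ▸ Submodule.subset_span (Set.mem_image_of_mem _ hr))

section ConjClosure

variable {G ι : Type*} [Group G]

/-- The subgroup generated by the conjugates `t ^ k * x i * t ^ (-k)` with `k` in the set `I` of
levels. The base group and the associated subgroups will be of this form. -/
def conjClosure (t : G) (x : ι → G) (I : Set ℤ) : Subgroup G :=
  Subgroup.closure (Set.image2 (fun k i => t ^ k * x i * (t ^ k)⁻¹) I Set.univ)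

variable {t : G} {x : ι → G} {I J : Set ℤ}

theorem conj_mem_conjClosure {k : ℤ} (hk : k ∈ I) (i : ι) :
    t ^ k * x i * (t ^ k)⁻¹ ∈ conjClosure t x I :=
  Subgroup.subset_closure (Set.mem_image2_of_mem hk (Set.mem_univ i))

theorem mem_conjClosure (h : 0 ∈ I) (i : ι) : x i ∈ conjClosure t x I := by
  simpa using conj_mem_conjClosure (t := t) (x := x) h i

theorem conjClosure_le {H : Subgroup G} :
    conjClosure t x I ≤ H ↔ ∀ k ∈ I, ∀ i, t ^ k * x i * (t ^ k)⁻¹ ∈ H := by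
  rw [conjClosure, Subgroup.closure_le, Set.image2_subset_iff]
  simp

theorem conjClosure_mono (h : I ⊆ J) : conjClosure t x I ≤ conjClosure t x J :=
  Subgroup.closure_mono (Set.image2_subset h subset_rfl)

theorem fg_conjClosure [Finite ι] (hI : I.Finite) : (conjClosure t x I).FG :=
  (Subgroup.fg_iff _).2 ⟨_, rfl, hI.image2 _ Set.finite_univ⟩

theorem conjClosure_le_ker {H : Type*} [Group H] {χ : G →* H} (hx : ∀ i, χ (x i) = 1) :
    conjClosure t x I ≤ χ.ker :=
  conjClosure_le.2 fun k _ i => by simp [MonoidHom.mem_ker, hx]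

theorem map_conjClosure {H : Type*} [Group H] (f : G →* H) :
    (conjClosure t x I).map f = conjClosure (f t) (f ∘ x) I := by
  rw [conjClosure, MonoidHom.map_closure, Set.image_image2]
  simp [conjClosure]

theorem map_conj_conjClosure (p : ℤ) :
    (conjClosure t x I).map (MulAut.conj (t ^ p)).toMonoidHom =
      conjClosure t x ((p + ·) '' I) := by
  rw [conjClosure, MonoidHom.map_closure, Set.image_image2, conjClosure, Set.image2_image_left]
  simp only [MulEquiv.toMonoidHom_eq_coe, MonoidHom.coe_coe, MulAut.conj_apply, zpow_add,
    mul_inv_rev, mul_assoc]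

theorem conj_mem_conjClosure_image {g : G} (hg : g ∈ conjClosure t x I) (p : ℤ) :
    t ^ p * g * (t ^ p)⁻¹ ∈ conjClosure t x ((p + ·) '' I) := by
  rw [← map_conj_conjClosure]
  exact Subgroup.mem_map_of_mem (MulAut.conj (t ^ p)).toMonoidHom hg

theorem map_conj_conjClosure_Ico (n : ℤ) :
    (conjClosure t x (Set.Ico 0 n)).map (MulAut.conj t).toMonoidHom =
      conjClosure t x (Set.Ioc 0 n) := by
  have h : (1 + ·) '' Set.Ico 0 n = Set.Ioc 0 n := by
    rw [Set.image_const_add_Ico]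
    ext k
    simp only [Set.mem_Ico, Set.mem_Ioc]
    lia
  rw [← h, ← map_conj_conjClosure, zpow_one]

theorem exists_mul_zpow_mem_conjClosure_univ
    (hgen : Subgroup.closure (insert t (Set.range x)) = ⊤) (g : G) :
    ∃ k : ℤ, g * t ^ k ∈ conjClosure t x Set.univ := by
  have hconj {g : G} (hg : g ∈ conjClosure t x Set.univ) (p : ℤ) :
      t ^ p * g * (t ^ p)⁻¹ ∈ conjClosure t x Set.univ :=
    conjClosure_mono (Set.subset_univ _) (conj_mem_conjClosure_image hg p)
  induction (hgen ▸ Subgroup.mem_top g : g ∈ Subgroup.closure _)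
    using Subgroup.closure_induction with
  | mem g hg =>
    obtain rfl | ⟨i, rfl⟩ := hg
    · exact ⟨-1, by simp⟩
    · exact ⟨0, by simpa using mem_conjClosure (Set.mem_univ 0) i⟩
  | one => exact ⟨0, by simp⟩
  | mul g h _ _ hg hh =>
    obtain ⟨k, hk⟩ := hg
    obtain ⟨l, hl⟩ := hh
    refine ⟨l + k, ?_⟩
    convert mul_mem hk (hconj hl (-k)) using 1
    group
  | inv g _ hg =>
    obtain ⟨k, hk⟩ := hg
    refine ⟨-k, ?_⟩
    convert hconj (inv_mem hk) k using 1
    group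

theorem ker_eq_conjClosure_univ {χ : G →* Multiplicative ℤ} (ht : χ t = .ofAdd 1)
    (hx : ∀ i, χ (x i) = 1) (hgen : Subgroup.closure (insert t (Set.range x)) = ⊤) :
    χ.ker = conjClosure t x Set.univ := by
  refine le_antisymm (fun g hg => ?_) (conjClosure_le_ker hx)
  obtain ⟨k, hk⟩ := exists_mul_zpow_mem_conjClosure_univ hgen g
  have hχ : χ (g * t ^ k) = 1 := conjClosure_le_ker hx hk
  rw [map_mul, (hg : χ g = 1), one_mul, map_zpow, ht, ← ofAdd_zsmul, ofAdd_eq_one] at hχ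
  obtain rfl : k = 0 := by simpa using hχ
  simpa using hk

theorem exists_mem_conjClosure_Icc {g : G} (hg : g ∈ conjClosure t x Set.univ) :
    ∃ m : ℤ, g ∈ conjClosure t x (Set.Icc (-m) m) := by
  have hdir : Directed (· ≤ ·) fun m : ℤ => conjClosure t x (Set.Icc (-m) m) :=
    Monotone.directed_le fun m n h => conjClosure_mono (Set.Icc_subset_Icc (neg_le_neg h) h)
  rw [← Subgroup.mem_iSup_of_directed hdir]
  refine conjClosure_le.2 (fun k _ i => ?_) hg
  exact Subgroup.mem_iSup_of_mem |k| (conj_mem_conjClosure (abs_le.1 le_rfl) i)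

theorem eventually_exists_conj_mem_conjClosure_Icc {χ : G →* Multiplicative ℤ}
    (ht : χ t = .ofAdd 1) (hx : ∀ i, χ (x i) = 1)
    (hgen : Subgroup.closure (insert t (Set.range x)) = ⊤) {g : G} (hg : χ g = 1) :
    ∀ᶠ n : ℤ in Filter.atTop,
      ∃ m : ℤ, t ^ m * g * (t ^ m)⁻¹ ∈ conjClosure t x (Set.Icc 0 n) := by
  obtain ⟨m, hm⟩ := exists_mem_conjClosure_Icc
    ((ker_eq_conjClosure_univ ht hx hgen).le hg)
  filter_upwards [Filter.eventually_ge_atTop (m + m)] with n hn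
  refine ⟨m, conjClosure_mono ?_ (conj_mem_conjClosure_image hm m)⟩
  rw [Set.image_const_add_Icc, add_neg_cancel]
  exact Set.Icc_subset_Icc_right hn

theorem closure_insert_conjClosure_eq_top (hgen : Subgroup.closure (insert t (Set.range x)) = ⊤)
    (hI : 0 ∈ I) : Subgroup.closure (insert t (conjClosure t x I : Set G)) = ⊤ := by
  rw [eq_top_iff, ← hgen]
  exact Subgroup.closure_mono
    (Set.insert_subset_insert (Set.range_subset_iff.2 (mem_conjClosure hI)))

-- `t ^ (k + 1) * x i * t ^ (-k - 1)` is the conjugate by `t` of the element at level `k`, on which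
-- `d` vanishes by induction, so only `d t - u (t ^ (k + 1) * x i * t ^ (-k - 1)) • d t` is left.
theorem IsCrossedHom.eq_zero_of_mem_conjClosure_Icc {R A : Type*} [Ring R] [AddCommGroup A]
    [Module R A] {u : G →* R} {d : G → A} (hd : IsCrossedHom u d) {n : ℤ}
    (hx : ∀ i, d (x i) = 0) (hfix : ∀ g ∈ conjClosure t x (Set.Ioc 0 n), u g • d t = d t)
    {g : G} (hg : g ∈ conjClosure t x (Set.Icc 0 n)) : d g = 0 := by
  refine hd.eq_zero_of_mem_closure ?_ hg
  rintro _ ⟨k, ⟨hk, hkn⟩, i, -, rfl⟩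
  induction k, hk using Int.leInduction with
  | base => simpa using hx i
  | succ k hk ih =>
    have hconj : t * (t ^ k * x i * (t ^ k)⁻¹) * t⁻¹ = t ^ (k + 1) * x i * (t ^ (k + 1))⁻¹ := by
      group
    have hmem : t ^ (k + 1) * x i * (t ^ (k + 1))⁻¹ ∈ conjClosure t x (Set.Ioc 0 n) :=
      conj_mem_conjClosure (Set.mem_Ioc.2 ⟨by lia, hkn⟩) i
    have ih := ih (by lia)
    beta_reduce at ih ⊢
    rw [← hconj, hd.map_conj, hconj, hfix _ hmem, ih, smul_zero, add_zero, sub_self]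

end ConjClosure

section CosetModule

open MonoidAlgebra

variable (K : Type*) [CommRing K] {G : Type*} [Group G] (H : Subgroup G)

/-- The permutation module `K[G ⧸ H]`: the `K`-chains on a set of edges permuted transitively by
`G`, with `H` the stabilizer of one of them. -/
abbrev CosetModule : Type _ :=
  (Representation.ofMulAction K G (G ⧸ H)).asModule

/-- The coset `H` as an element of `K[G ⧸ H]`. -/
noncomputable def baseCoset : CosetModule K H :=
  (Representation.ofMulAction K G (G ⧸ H)).asModuleEquiv.symm (single ((1 : G) : G ⧸ H) 1)

/-- The coefficient at the coset `H` of an element of `K[G ⧸ H]`. -/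
noncomputable def baseCoeff : CosetModule K H →+ K :=
  (Finsupp.applyAddHom ((1 : G) : G ⧸ H)).comp (coeffAddEquiv.toAddMonoidHom.comp
    (Representation.ofMulAction K G (G ⧸ H)).asModuleEquiv.toLinearMap.toAddMonoidHom)

theorem of_smul_baseCoset (g : G) : of K G g • baseCoset K H =
    (Representation.ofMulAction K G (G ⧸ H)).asModuleEquiv.symm (single (g : G ⧸ H) 1) := by
  rw [baseCoset, ← Representation.asModuleEquiv_symm_map_rho, Representation.ofMulAction_single,
    MulAction.Quotient.smul_coe, smul_eq_mul, mul_one]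

variable {H}

theorem of_smul_baseCoset_of_mem {g : G} (hg : g ∈ H) :
    of K G g • baseCoset K H = baseCoset K H := by
  have heq : (g : G ⧸ H) = (1 : G) := by simpa [QuotientGroup.eq] using hg
  rw [of_smul_baseCoset, baseCoset, heq]

theorem baseCoeff_baseCoset : baseCoeff K H (baseCoset K H) = 1 := by
  simp [baseCoeff, baseCoset]

theorem baseCoeff_of_smul_baseCoset {g : G} (hg : g ∉ H) :
    baseCoeff K H (of K G g • baseCoset K H) = 0 := by
  have hne : (g : G ⧸ H) ≠ (1 : G) := by simpa [QuotientGroup.eq] using hg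
  rw [of_smul_baseCoset]
  simp [baseCoeff, hne]

end CosetModule

/-- `IsCut B t U E` says that `U`, as a set of vertices `g B` of the graph with an edge from `g B`
to `g t B` for each `g`, contains both or neither of the ends of every edge `g ∉ E`. -/
structure IsCut {G : Type*} [Group G] (B : Subgroup G) (t : G) (U E : Set G) : Prop where
  mul_mem_iff : ∀ g, ∀ b ∈ B, g * b ∈ U ↔ g ∈ U
  mul_t_mem_iff : ∀ g ∉ E, g * t ∈ U ↔ g ∈ U

theorem IsCrossedHom.isCut_baseCoeff_ne_zero {K G : Type*} [CommRing K] [Group G]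
    {B H : Subgroup G} {t : G} {δ : G → CosetModule K H}
    (hδ : IsCrossedHom (MonoidAlgebra.of K G) δ) (hB : ∀ b ∈ B, δ b = 0)
    (ht : δ t = baseCoset K H) : IsCut B t {g | baseCoeff K H (δ g) ≠ 0} H where
  mul_mem_iff g b hb := by simp only [Set.mem_ofPred_eq, hδ g b, hB b hb, smul_zero, add_zero]
  mul_t_mem_iff g hg := by
    simp only [Set.mem_ofPred_eq, hδ g t, ht, map_add, baseCoeff_of_smul_baseCoset K hg, add_zero]

theorem closure_insert_of_none_eq_top {ι : Type*} : Subgroup.closure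
    (insert (.of none) (Set.range fun i : ι => FreeGroup.of (some i))) = ⊤ := by
  rw [← FreeGroup.closure_range_of, Option.range_eq]
  rfl

theorem lift_elim_surjective {G ι : Type*} [Group G] {t : G} {x : ι → G}
    (hgen : Subgroup.closure (insert t (Set.range x)) = ⊤) :
    Function.Surjective (FreeGroup.lift fun o : Option ι => o.elim t x) := by
  rw [← MonoidHom.range_eq_top, FreeGroup.range_lift_eq_closure, Option.range_eq]
  exact hgen

section FiniteType

open MonoidAlgebra

variable {K : Type*} [CommRing K] {G : Type*} [Group G]
  {χ : G →* Multiplicative ℤ} {t : G} {ι : Type*} [Finite ι] {x : ι → G}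

-- Each relator of a finite detecting set has a conjugate in `conjClosure t x (Icc 0 n)` for large
-- `n`, hence is killed by the derivation `t ↦ c`, `x i ↦ 0` of the free group.
theorem exists_forall_exists_isCrossedHom (hG : Group.IsTypeFP K G 2) (ht : χ t = .ofAdd 1)
    (hx : ∀ i, χ (x i) = 1) (hgen : Subgroup.closure (insert t (Set.range x)) = ⊤) :
    ∃ n : ℤ, 0 ≤ n ∧ ∀ {A : Type*} [AddCommGroup A] [Module (MonoidAlgebra K G) A] (c : A),
      (∀ g ∈ conjClosure t x (Set.Ioc 0 n), of K G g • c = c) →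
        ∃ δ : G → A, IsCrossedHom (of K G) δ ∧ δ t = c ∧
          ∀ g ∈ conjClosure t x (Set.Icc 0 n), δ g = 0 := by
  set φ : FreeGroup (Option ι) →* G := FreeGroup.lift fun o => o.elim t x
  have hφ : Function.Surjective φ := lift_elim_surjective hgen
  have hφt : φ (.of none) = t := by simp [φ]
  have hφx (i) : φ (.of (some i)) = x i := by simp [φ]
  obtain ⟨R, hRfin, hRker, hR⟩ := exists_finite_relators hG hφ
  have hRconj := (Filter.eventually_all_finite hRfin).2 fun r hr =>
    eventually_exists_conj_mem_conjClosure_Icc (χ := χ.comp φ) (g := r)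
      (by rw [MonoidHom.comp_apply, hφt, ht])
      (fun i => by rw [MonoidHom.comp_apply, hφx, hx]) closure_insert_of_none_eq_top
      (by rw [MonoidHom.comp_apply, hRker hr, map_one])
  obtain ⟨n, hn, hRn⟩ := ((Filter.eventually_ge_atTop 0).and hRconj).exists
  refine ⟨n, hn, fun {A} _ _ c hc => ?_⟩
  obtain ⟨e, he, heX⟩ := exists_isCrossedHom_of_eq ((of K G).comp φ)
    fun o : Option ι => o.elim c fun _ => 0
  have heR : ∀ r ∈ R, e r = 0 := fun r hr => by
    obtain ⟨m, hm⟩ := hRn r hr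
    refine he.eq_zero_of_map_conj_eq_zero (by rw [MonoidHom.comp_apply, hRker hr, map_one])
      (he.eq_zero_of_mem_conjClosure_Icc (fun i => heX (some i)) (fun g hg => ?_) hm)
    have hφg := Subgroup.mem_map_of_mem φ hg
    rw [map_conjClosure, hφt, (funext hφx : φ ∘ _ = x)] at hφg
    rw [heX none]
    exact hc _ hφg
  obtain ⟨δ, hδ, hδφ⟩ := he.exists_descent hφ (hR he heR)
  have hδt : δ t = c := by rw [← hφt, hδφ, heX]; rfl
  have hδx (i) : δ (x i) = 0 := by rw [← hφx, hδφ, heX]; rfl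
  exact ⟨δ, hδ, hδt, fun g => hδ.eq_zero_of_mem_conjClosure_Icc hδx (hδt.symm ▸ hc)⟩

theorem exists_isCut_conjClosure [Nontrivial K] (hG : Group.IsTypeFP K G 2) (ht : χ t = .ofAdd 1)
    (hx : ∀ i, χ (x i) = 1) (hgen : Subgroup.closure (insert t (Set.range x)) = ⊤) :
    ∃ n : ℤ, 0 ≤ n ∧ ∃ U : Set G, 1 ∉ U ∧ t ∈ U ∧
      IsCut (conjClosure t x (Set.Icc 0 n)) t U (conjClosure t x (Set.Ioc 0 n)) := by
  obtain ⟨n, hn, h⟩ := exists_forall_exists_isCrossedHom hG ht hx hgen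
  obtain ⟨δ, hδ, hδt, hδB⟩ := h (baseCoset K (conjClosure t x (Set.Ioc 0 n)))
    fun g hg => of_smul_baseCoset_of_mem K hg
  refine ⟨n, hn, _, ?_, ?_, hδ.isCut_baseCoeff_ne_zero hδB hδt⟩
  · simp [hδ.map_one]
  · simp [hδt, baseCoeff_baseCoset]

end FiniteType

namespace IsCut

variable {G : Type*} [Group G] {B : Subgroup G} {t : G} {U V E F : Set G}

theorem mem_iff_of_mem (hU : IsCut B t U E) {b : G} (hb : b ∈ B) : b ∈ U ↔ 1 ∈ U := by
  rw [← hU.mul_mem_iff 1 b hb, one_mul]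

theorem compl (hU : IsCut B t U E) : IsCut B t Uᶜ E where
  mul_mem_iff g b hb := not_congr (hU.mul_mem_iff g b hb)
  mul_t_mem_iff g hg := not_congr (hU.mul_t_mem_iff g hg)

theorem preimage_mul_left (hU : IsCut B t U E) (a : G) :
    IsCut B t ((a * ·) ⁻¹' U) ((a * ·) ⁻¹' E) where
  mul_mem_iff g b hb := by simpa [mul_assoc] using hU.mul_mem_iff (a * g) b hb
  mul_t_mem_iff g hg := by simpa [mul_assoc] using hU.mul_t_mem_iff (a * g) hg

-- The set `U \ V` cannot change along any edge: on the edges in `E ∪ F` both ends are outside it.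
theorem subset (hU : IsCut B t U E) (hV : IsCut B t V F)
    (hgen : Subgroup.closure (insert t (B : Set G)) = ⊤) (hdisj : Disjoint E F)
    (hB : ∀ z ∈ E ∪ F, z ∈ B ∨ z * t ∈ B) (h1U : 1 ∉ U) (h1V : 1 ∈ V) : U ⊆ V := by
  have hmul_t (z : G) : z * t ∈ U \ V ↔ z ∈ U \ V := by
    by_cases hzE : z ∈ E
    · have hVz := hV.mul_t_mem_iff z (hdisj.notMem_of_mem_left hzE)
      obtain hz | hz := hB z (.inl hzE)
      · simp [hVz, (hV.mem_iff_of_mem hz).2 h1V]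
      · simp [← hVz, (hV.mem_iff_of_mem hz).2 h1V]
    · have hUz := hU.mul_t_mem_iff z hzE
      by_cases hzF : z ∈ F
      · obtain hz | hz := hB z (.inr hzF)
        · simp [hUz, mt (hU.mem_iff_of_mem hz).1 h1U]
        · simp [← hUz, mt (hU.mem_iff_of_mem hz).1 h1U]
      · rw [Set.mem_sdiff, Set.mem_sdiff, hUz, hV.mul_t_mem_iff z hzF]
  have hmul (g z : G) : z * g ∈ U \ V ↔ z ∈ U \ V := by
    induction (hgen ▸ Subgroup.mem_top g : g ∈ Subgroup.closure _)
      using Subgroup.closure_induction generalizing z with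
    | mem g hg =>
      obtain rfl | hg := hg
      · exact hmul_t z
      · rw [Set.mem_sdiff, Set.mem_sdiff, hU.mul_mem_iff z g hg, hV.mul_mem_iff z g hg]
    | one => rw [mul_one]
    | mul g h _ _ hg hh => rw [← mul_assoc, hh, hg]
    | inv g _ hg => rw [← hg, inv_mul_cancel_right]
  intro z hz
  by_contra hzV
  exact h1U ((hmul z 1).1 (by simpa using ⟨hz, hzV⟩)).1

end IsCut

section PingPong

variable {G : Type*} [Group G] {B : Subgroup G} {S T : Subgroup B} {t : G} {U E : Set G}

/-- The translate of the half-space `U` or of its complement that consists of the vertices reached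
from the base vertex through the edge labelled `t ^ ε`. -/
def halfSpace (t : G) (U : Set G) (ε : ℤˣ) : Set G :=
  if ε = 1 then U else (t * ·) ⁻¹' Uᶜ

/-- The edges in the coboundary of `halfSpace t U ε` when `E` is that of `U`. -/
def halfSpaceEdges (t : G) (E : Set G) (ε : ℤˣ) : Set G :=
  if ε = 1 then E else (t * ·) ⁻¹' E

theorem IsCut.isCut_halfSpace (hU : IsCut B t U E) (ε : ℤˣ) :
    IsCut B t (halfSpace t U ε) (halfSpaceEdges t E ε) := by
  obtain rfl | rfl := Int.units_eq_one_or ε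
  · exact hU
  · exact hU.compl.preimage_mul_left t

theorem one_notMem_halfSpace (h1 : 1 ∉ U) (ht : t ∈ U) (ε : ℤˣ) : 1 ∉ halfSpace t U ε := by
  obtain rfl | rfl := Int.units_eq_one_or ε
  · exact h1
  · simpa [halfSpace] using ht

theorem zpow_mem_halfSpace (h1 : 1 ∉ U) (ht : t ∈ U) (ε : ℤˣ) :
    t ^ (ε : ℤ) ∈ halfSpace t U ε := by
  obtain rfl | rfl := Int.units_eq_one_or ε
  · simpa [halfSpace] using ht
  · simpa [halfSpace] using h1

theorem zpow_mul_mem_halfSpaceEdges_iff {ε : ℤˣ} {z : G} :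
    t ^ (ε : ℤ) * z ∈ halfSpaceEdges t E ε ↔ z ∈ halfSpaceEdges t E (-ε) := by
  obtain rfl | rfl := Int.units_eq_one_or ε <;> simp [halfSpaceEdges]

variable {μ : S ≃* T}

theorem mem_halfSpaceEdges_neg_one_iff (hμ : ∀ s : S, (μ s : G) = t * s * t⁻¹) {z : G} :
    z ∈ halfSpaceEdges t (T.map B.subtype) (-1) ↔ z * t ∈ S.map B.subtype := by
  have hz : z ∈ halfSpaceEdges t (T.map B.subtype) (-1) ↔ t * z ∈ T.map B.subtype := by
    simp [halfSpaceEdges]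
  rw [hz]
  constructor
  · rintro ⟨y, hy, hyz⟩
    refine ⟨μ.symm ⟨y, hy⟩, (μ.symm ⟨y, hy⟩).2, ?_⟩
    have hconj := hμ (μ.symm ⟨y, hy⟩)
    rw [MulEquiv.apply_symm_apply, ← Subgroup.subtype_apply, hyz] at hconj
    simpa [mul_assoc, mul_inv_eq_iff_eq_mul, eq_mul_inv_iff_mul_eq] using hconj.symm
  · rintro ⟨s, hs, hsz⟩
    refine ⟨μ ⟨s, hs⟩, (μ ⟨s, hs⟩).2, ?_⟩
    rw [Subgroup.subtype_apply] at hsz ⊢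
    rw [hμ, hsz, ← mul_assoc, mul_inv_cancel_right]

theorem mem_or_mul_mem_of_mem_halfSpaceEdges (hμ : ∀ s : S, (μ s : G) = t * s * t⁻¹)
    {ε : ℤˣ} {z : G} (hz : z ∈ halfSpaceEdges t (T.map B.subtype) ε) : z ∈ B ∨ z * t ∈ B := by
  obtain rfl | rfl := Int.units_eq_one_or ε
  · exact .inl (Subgroup.map_subtype_le T hz)
  · exact .inr (Subgroup.map_subtype_le S ((mem_halfSpaceEdges_neg_one_iff hμ).1 hz))

theorem mem_toSubgroup_of_mul_mem_halfSpaceEdges_neg (hμ : ∀ s : S, (μ s : G) = t * s * t⁻¹)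
    {ε : ℤˣ} {g : B} {z : G} (hz : z ∈ halfSpaceEdges t (T.map B.subtype) (-ε))
    (hgz : g * z ∈ halfSpaceEdges t (T.map B.subtype) (-ε)) :
    g ∈ HNNExtension.toSubgroup S T ε := by
  have hg_of_mul (H : Subgroup B) {w : G} (hw : w ∈ H.map B.subtype)
      (hgw : g * w ∈ H.map B.subtype) : g ∈ H := by
    rw [← Subgroup.mem_map_iff_mem B.subtype_injective]
    exact (Subgroup.mul_mem_cancel_right _ hw).1 hgw
  obtain rfl | rfl := Int.units_eq_one_or ε
  · rw [mem_halfSpaceEdges_neg_one_iff hμ] at hz hgz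
    exact hg_of_mul S hz (by rwa [← mul_assoc])
  · exact hg_of_mul T hz hgz

theorem mem_of_mem_halfSpaceEdges_of_mem_neg (hμ : ∀ s : S, (μ s : G) = t * s * t⁻¹)
    {ε : ℤˣ} {g : B} {z : G} (hz : z ∈ halfSpaceEdges t (T.map B.subtype) ε)
    (hgz : g * z ∈ halfSpaceEdges t (T.map B.subtype) (-ε)) : t ∈ B := by
  have hmem {y : G} (hy : y ∈ B) (hyt : y * t ∈ B) : t ∈ B :=
    (Subgroup.mul_mem_cancel_left B hy).1 hyt
  obtain rfl | rfl := Int.units_eq_one_or ε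
  · rw [mem_halfSpaceEdges_neg_one_iff hμ] at hgz
    exact hmem (mul_mem g.2 (Subgroup.map_subtype_le T hz)) (Subgroup.map_subtype_le S hgz)
  · rw [mem_halfSpaceEdges_neg_one_iff hμ] at hz
    exact hmem ((Subgroup.mul_mem_cancel_left B g.2).1 (Subgroup.map_subtype_le T hgz))
      (Subgroup.map_subtype_le S hz)

theorem disjoint_halfSpaceEdges (hμ : ∀ s : S, (μ s : G) = t * s * t⁻¹) (ht : t ∉ B)
    {ε ε' : ℤˣ} {g : B} (hg : g ∈ HNNExtension.toSubgroup S T ε → ε = ε') :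
    Disjoint (halfSpaceEdges t (T.map B.subtype) ε')
      ((t ^ (ε : ℤ) * g * ·) ⁻¹' halfSpaceEdges t (T.map B.subtype) ε) := by
  refine Set.disjoint_left.2 fun z hz hgz => ?_
  rw [Set.mem_preimage, mul_assoc, zpow_mul_mem_halfSpaceEdges_iff] at hgz
  by_cases hε : ε = ε'
  · exact ht (mem_of_mem_halfSpaceEdges_of_mem_neg hμ (hε ▸ hz) hgz)
  · obtain rfl : ε' = -ε := Int.units_ne_iff_eq_neg.1 (Ne.symm hε)
    exact hε (hg (mem_toSubgroup_of_mul_mem_halfSpaceEdges_neg hμ hz hgz))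

theorem IsCut.zpow_mul_mem_halfSpace (hU : IsCut B t U (T.map B.subtype))
    (hμ : ∀ s : S, (μ s : G) = t * s * t⁻¹)
    (hgen : Subgroup.closure (insert t (B : Set G)) = ⊤) (h1 : 1 ∉ U) (ht : t ∈ U)
    {ε ε' : ℤˣ} {g : B} (hg : g ∈ HNNExtension.toSubgroup S T ε → ε = ε') {z : G}
    (hz : z ∈ halfSpace t U ε') : t ^ (ε : ℤ) * g * z ∈ halfSpace t U ε := by
  refine (hU.isCut_halfSpace ε').subset ((hU.isCut_halfSpace ε).preimage_mul_left _) hgen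
    (disjoint_halfSpaceEdges hμ (fun htB => h1 ((hU.mem_iff_of_mem htB).1 ht)) hg) ?_
    (one_notMem_halfSpace h1 ht ε') ?_ hz
  · rintro z (hz | hz)
    · exact mem_or_mul_mem_of_mem_halfSpaceEdges hμ hz
    · rw [Set.mem_preimage, mul_assoc, zpow_mul_mem_halfSpaceEdges_iff] at hz
      simpa only [mul_assoc, Subgroup.mul_mem_cancel_left B g.2] using
        mem_or_mul_mem_of_mem_halfSpaceEdges hμ hz
  · rw [Set.mem_preimage, mul_one, (hU.isCut_halfSpace ε).mul_mem_iff _ _ g.2]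
    exact zpow_mem_halfSpace h1 ht ε

end PingPong

theorem exists_reducedWord_prod_eq {B : Type*} [Group B] {S T : Subgroup B} {μ : S ≃* T}
    (h : HNNExtension B S T μ) :
    ∃ w : HNNExtension.NormalWord.ReducedWord B S T, w.prod μ = h := by
  obtain ⟨d⟩ := HNNExtension.NormalWord.TransversalPair.nonempty B S T
  refine ⟨(h • (HNNExtension.NormalWord.empty : HNNExtension.NormalWord d)).toReducedWord, ?_⟩
  rw [HNNExtension.NormalWord.prod_smul, HNNExtension.NormalWord.prod_empty, mul_one]

section Bijectivity

variable {G : Type*} [Group G] {B : Subgroup G} {S T : Subgroup B} {μ : S ≃* T} {t : G}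

/-- The homomorphism from the HNN extension to `G` that is the inclusion on `B` and sends the
stable letter to `t`. -/
def hnnHom (hμ : ∀ s : S, (μ s : G) = t * s * t⁻¹) : HNNExtension B S T μ →* G :=
  HNNExtension.lift B.subtype t fun s => by simp [hμ]

theorem hnnHom_of (hμ : ∀ s : S, (μ s : G) = t * s * t⁻¹) (b : B) :
    hnnHom hμ (HNNExtension.of b) = b :=
  HNNExtension.lift_of _ _ _ b

theorem hnnHom_t (hμ : ∀ s : S, (μ s : G) = t * s * t⁻¹) : hnnHom hμ HNNExtension.t = t :=
  HNNExtension.lift_t _ _ _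

theorem hnnHom_surjective (hμ : ∀ s : S, (μ s : G) = t * s * t⁻¹)
    (hgen : Subgroup.closure (insert t (B : Set G)) = ⊤) : Function.Surjective (hnnHom hμ) := by
  rw [← MonoidHom.range_eq_top, eq_top_iff, ← hgen, Subgroup.closure_le, Set.insert_subset_iff]
  exact ⟨⟨HNNExtension.t, hnnHom_t hμ⟩, fun b hb => ⟨HNNExtension.of ⟨b, hb⟩, hnnHom_of hμ ⟨b, hb⟩⟩⟩

namespace IsCut

variable {U : Set G} (hU : IsCut B t U (T.map B.subtype))

include hU

theorem prod_mem_halfSpace (hμ : ∀ s : S, (μ s : G) = t * s * t⁻¹)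
    (hgen : Subgroup.closure (insert t (B : Set G)) = ⊤) (h1 : 1 ∉ U) (ht : t ∈ U)
    {a : ℤˣ × B} {l : List (ℤˣ × B)}
    (hl : (a :: l).IsChain fun a b => a.2 ∈ HNNExtension.toSubgroup S T a.1 → a.1 = b.1) :
    ((a :: l).map fun a => t ^ (a.1 : ℤ) * (a.2 : G)).prod ∈ halfSpace t U a.1 := by
  induction l generalizing a with
  | nil =>
    rw [List.map_singleton, List.prod_singleton, (hU.isCut_halfSpace a.1).mul_mem_iff _ _ a.2.2]
    exact zpow_mem_halfSpace h1 ht a.1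
  | cons b l ih =>
    rw [List.isChain_cons_cons] at hl
    rw [List.map_cons, List.prod_cons]
    exact hU.zpow_mul_mem_halfSpace hμ hgen h1 ht hl.1 (ih hl.2)

theorem hnnHom_injective (hμ : ∀ s : S, (μ s : G) = t * s * t⁻¹)
    (hgen : Subgroup.closure (insert t (B : Set G)) = ⊤) (h1 : 1 ∉ U) (ht : t ∈ U) :
    Function.Injective (hnnHom hμ) := by
  rw [injective_iff_map_eq_one]
  intro h hh
  obtain ⟨⟨b, l, hl⟩, rfl⟩ := exists_reducedWord_prod_eq h
  have hprod : (b : G) * (l.map fun a => t ^ (a.1 : ℤ) * (a.2 : G)).prod = 1 := by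
    simpa [HNNExtension.NormalWord.ReducedWord.prod, map_list_prod, Function.comp_def,
      hnnHom_of hμ, hnnHom_t hμ] using hh
  cases l with
  | nil =>
    obtain rfl : b = 1 := by simpa using hprod
    simp [HNNExtension.NormalWord.ReducedWord.prod]
  | cons a l =>
    refine absurd (hU.prod_mem_halfSpace hμ hgen h1 ht hl) ?_
    rw [eq_inv_of_mul_eq_one_right hprod, (hU.isCut_halfSpace a.1).mem_iff_of_mem (inv_mem b.2)]
    exact one_notMem_halfSpace h1 ht a.1

/-- The isomorphism onto `G` given by `hnnHom` when a cut along `T` separates `1` from `t`. -/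
noncomputable def hnnEquiv (hμ : ∀ s : S, (μ s : G) = t * s * t⁻¹)
    (hgen : Subgroup.closure (insert t (B : Set G)) = ⊤) (h1 : 1 ∉ U) (ht : t ∈ U) :
    HNNExtension B S T μ ≃* G :=
  .ofBijective (hnnHom hμ) ⟨hU.hnnHom_injective hμ hgen h1 ht, hnnHom_surjective hμ hgen⟩

end IsCut

end Bijectivity

section ConjugationEquiv

variable {G : Type*} [Group G]

/-- Conjugation by `t` as an isomorphism between subgroups of `B`. -/
noncomputable def conjEquivSubgroupOf (t : G) {B S T : Subgroup G} (hS : S ≤ B) (hT : T ≤ B)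
    (hST : S.map (MulAut.conj t).toMonoidHom = T) : S.subgroupOf B ≃* T.subgroupOf B :=
  (Subgroup.subgroupOfEquivOfLe hS).trans <|
    (S.equivMapOfInjective _ (MulAut.conj t).injective).trans <|
      (MulEquiv.subgroupCongr hST).trans (Subgroup.subgroupOfEquivOfLe hT).symm

theorem coe_conjEquivSubgroupOf (t : G) {B S T : Subgroup G} (hS : S ≤ B) (hT : T ≤ B)
    (hST : S.map (MulAut.conj t).toMonoidHom = T) (s : S.subgroupOf B) :
    (conjEquivSubgroupOf t hS hT hST s : G) = t * s * t⁻¹ := rfl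

theorem fg_subgroupOf {B S : Subgroup G} (h : S.FG) (hS : S ≤ B) : (S.subgroupOf B).FG := by
  rw [← Group.fg_iff_subgroup_fg] at h ⊢
  exact Group.fg_of_surjective (f := (Subgroup.subgroupOfEquivOfLe hS).symm.toMonoidHom)
    (Subgroup.subgroupOfEquivOfLe hS).symm.surjective

end ConjugationEquiv

theorem exists_finite_subset_ker_closure_insert_eq_top {G : Type*} [Group G] [Group.FG G]
    {χ : G →* Multiplicative ℤ} {t : G} (ht : χ t = .ofAdd 1) :
    ∃ Y : Set G, Y.Finite ∧ Y ⊆ χ.ker ∧ Subgroup.closure (insert t Y) = ⊤ := by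
  obtain ⟨Y, hY⟩ := Group.FG.out (G := G)
  refine ⟨(fun y => y * (t ^ (χ y).toAdd)⁻¹) '' Y, Y.finite_toSet.image _, ?_, ?_⟩
  · rintro _ ⟨y, -, rfl⟩
    simp [MonoidHom.mem_ker, ht, ← ofAdd_zsmul]
  rw [eq_top_iff, ← hY, Subgroup.closure_le]
  intro y hy
  rw [← inv_mul_cancel_right y (t ^ (χ y).toAdd)]
  exact mul_mem (Subgroup.subset_closure (.inr ⟨y, hy, rfl⟩))
    (zpow_mem (Subgroup.subset_closure (.inl rfl)) _)

theorem theoremB3p1 {G : Type*} [Group G] [Group.FG G] {K : Type*} [CommRing K] [Nontrivial K]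
    (hG : Group.IsTypeFP K G 2)
    (χ : G →* Multiplicative ℤ) (t : G) (ht : χ t = Multiplicative.ofAdd 1) :
    ∃ (B : Subgroup G) (S T : Subgroup B) (μ : S ≃* T),
      B ≤ χ.ker ∧ B.FG ∧ S.FG ∧ T.FG ∧
      (∀ s : S, ((μ s : B) : G) = t * ((s : B) : G) * t⁻¹) ∧
      ∃ τ : HNNExtension B S T μ ≃* G,
        (∀ b : B, τ (HNNExtension.of b) = (b : G)) ∧ τ HNNExtension.t = t := by
  obtain ⟨Y, hYfin, hY, hgen⟩ := exists_finite_subset_ker_closure_insert_eq_top ht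
  have := hYfin.to_subtype
  set x : Y → G := Subtype.val
  have hx (y : Y) : χ (x y) = 1 := hY y.2
  replace hgen : Subgroup.closure (insert t (Set.range x)) = ⊤ := by rwa [Subtype.range_coe]
  obtain ⟨n, hn, U, h1, htU, hU⟩ := exists_isCut_conjClosure hG ht hx hgen
  have hS : conjClosure t x (Set.Ico 0 n) ≤ conjClosure t x (Set.Icc 0 n) :=
    conjClosure_mono Set.Ico_subset_Icc_self
  have hT : conjClosure t x (Set.Ioc 0 n) ≤ conjClosure t x (Set.Icc 0 n) :=
    conjClosure_mono Set.Ioc_subset_Icc_self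
  have hμ := coe_conjEquivSubgroupOf t hS hT (map_conj_conjClosure_Ico n)
  have hgenB := closure_insert_conjClosure_eq_top hgen (Set.left_mem_Icc.2 hn)
  rw [← Subgroup.map_subgroupOf_eq_of_le hT] at hU
  exact ⟨_, _, _, _, conjClosure_le_ker hx, fg_conjClosure (Set.finite_Icc 0 n),
    fg_subgroupOf (fg_conjClosure (Set.finite_Ico 0 n)) hS,
    fg_subgroupOf (fg_conjClosure (Set.finite_Ioc 0 n)) hT, hμ,
    hU.hnnEquiv hμ hgenB h1 htU, hnnHom_of hμ, hnnHom_t hμ⟩
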